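/- A Dyck N-walk of length $n$ is a sequence $w=(w_1,\dots,w_n)$ of N-steps $w_i\in\{\{-1\},\{1\},\{-1,1\}\}$. Its reachable points are the sums $v_1+\dots+v_n$ with $v_i\in w_i$ for all $i$; let $\min(w)$ and $\max(w)$ be the smallest and the largest of them, and $|w|=n$. The N-walk $w$ is an N-bridge if $0$ is a reachable point. Let $K$ be a field of characteristic $0$, let $p_{-1},p_1,p_{-1,1}\in K$ be nonzero weights of the three N-steps (for instance indeterminates over $\mathbb{Q}$, or positive real numbers), and let $$B(x,y,t)=\sum_{w\text{ Dyck N-bridge}}\Big(\prod_{s\in w}p_s\Big)\,x^{\min(w)}y^{\max(w)}t^{|w|}\in K(x,y)[[t]].$$ 1. $B(x,y,t)$ is algebraic over $K(x,y,t)$, and its minimal polynomial over this field has degree $4$. 2. For $p_{-1}=p_1=p_{-1,1}=1$, the generating function $B(1,1,t)=\sum_n b_n t^n$ of unweighted Dyck N-bridges, where $b_n$ is the number of Dyck N-bridges of length $n$, is algebraic of degree $2$ over $K(t)$, and $$B(1,1,t)=\frac{1-6t^2}{\sqrt{1-8t^2}\,(1-9t^2)}=1+7t^2+63t^4+583t^6+5407t^8+O(t^{10}),$$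 where $\sqrt{1-8t^2}$ is the power series square root with constant term $1$. 3. As $n\to\infty$, $$b_n=\frac{1+(-1)^n}{2}\left(3^n-\frac{2\sqrt2}{\sqrt\pi}\,\frac{8^{n/2}}{\sqrt n}+O\!\left(\frac{8^{n/2}}{n^{3/2}}\right)\right).$$ In particular almost all Dyck N-walks of even length are N-bridges: $b_{2m}/3^{2m}\to1$ as $m\to\infty$, where $3^{2m}$ is the number of Dyck N-walks of length $2m$. -/

import Mathlib

open Filter Asymptotics
open scoped BigOperators PowerSeries

namespace NWalk

/-- The endpoint of a classical walk `v = (v₁, …, vₙ)` started at the origin. -/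
def endpoint {n : ℕ} (v : Fin n → ℤ) : ℤ := ∑ i, v i

/-- A bridge is a walk that ends at the origin. -/
def IsBridge {n : ℕ} (v : Fin n → ℤ) : Prop := endpoint v = 0

/-- A walk `v` is compatible with an N-walk `w` (a sequence of sets of integers) of the same
length if each step of `v` belongs to the corresponding N-step of `w`. -/
def Compatible {n : ℕ} (v : Fin n → ℤ) (w : Fin n → Finset ℤ) : Prop := ∀ i, v i ∈ w i

/-- An N-bridge is an N-walk compatible with at least one bridge. -/
def IsNBridge {n : ℕ} (w : Fin n → Finset ℤ) : Prop := ∃ v, Compatible v w ∧ IsBridge v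

/-- The reachable points of an N-walk: the endpoints of all walks compatible with it. -/
def reachable {n : ℕ} (w : Fin n → Finset ℤ) : Set ℤ := {z | ∃ v, Compatible v w ∧ endpoint v = z}

/-- The minimum reachable point. -/
noncomputable def minReach {n : ℕ} (w : Fin n → Finset ℤ) : ℤ := sInf (reachable w)

/-- The maximum reachable point. -/
noncomputable def maxReach {n : ℕ} (w : Fin n → Finset ℤ) : ℤ := sSup (reachable w)

theorem reachable_finite {n : ℕ} (w : Fin n → Finset ℤ) : (reachable w).Finite := by
  refine ((Fintype.piFinset w).finite_toSet.image endpoint).subset ?_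
  rintro z ⟨v, hv, rfl⟩
  exact ⟨v, by simpa [Compatible] using hv, rfl⟩

theorem reachable_nonempty {n : ℕ} (w : Fin n → Finset ℤ) (hw : ∀ i, (w i).Nonempty) :
    (reachable w).Nonempty := by
  choose v hv using hw
  exact ⟨_, v, hv, rfl⟩

/-- When all N-steps are nonempty, `minReach` is a genuine minimum. -/
theorem isLeast_minReach {n : ℕ} (w : Fin n → Finset ℤ) (hw : ∀ i, (w i).Nonempty) :
    IsLeast (reachable w) (minReach w) :=
  ⟨Int.csInf_mem (reachable_nonempty w hw) (reachable_finite w).bddBelow,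
    fun _ hz => csInf_le (reachable_finite w).bddBelow hz⟩

/-- When all N-steps are nonempty, `maxReach` is a genuine maximum. -/
theorem isGreatest_maxReach {n : ℕ} (w : Fin n → Finset ℤ) (hw : ∀ i, (w i).Nonempty) :
    IsGreatest (reachable w) (maxReach w) :=
  ⟨Int.csSup_mem (reachable_nonempty w hw) (reachable_finite w).bddAbove,
    fun _ hz => le_csSup (reachable_finite w).bddAbove hz⟩

/-- The Dyck N-step set: the nonempty subsets of `{-1, 1}`. -/
def dyckNSteps : Finset (Finset ℤ) := {{-1}, {1}, {-1, 1}}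

/-- The Dyck N-walks of length `n`. -/
def dyckNWalks (n : ℕ) : Finset (Fin n → Finset ℤ) := Fintype.piFinset fun _ => dyckNSteps

open Classical in
/-- The Dyck N-bridges of length `n`. -/
noncomputable def dyckNBridges (n : ℕ) : Finset (Fin n → Finset ℤ) :=
  (dyckNWalks n).filter IsNBridge

/-- The generating function `∑ (∏_{s ∈ w} p s) x ^ min(w) y ^ max(w) t ^ |w|` over all Dyck
N-bridges `w`, as a power series in `t`, where `p` gives the weights of the N-steps. -/
noncomputable def dyckBridgeGF {L : Type*} [Field L] (p : Finset ℤ → L) (x y : L) : L⟦X⟧ :=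
  PowerSeries.mk fun n => ∑ w ∈ dyckNBridges n, (∏ i, p (w i)) * x ^ minReach w * y ^ maxReach w

/-- The field `K(x, y)` of rational functions in two variables. -/
abbrev RatXY (K : Type*) [Field K] : Type _ := FractionRing (MvPolynomial (Fin 2) K)

/-- The variable `x` of `K(x, y)`. -/
noncomputable def varX (K : Type*) [Field K] : RatXY K :=
  algebraMap (MvPolynomial (Fin 2) K) (RatXY K) (MvPolynomial.X 0)

/-- The variable `y` of `K(x, y)`. -/
noncomputable def varY (K : Type*) [Field K] : RatXY K :=
  algebraMap (MvPolynomial (Fin 2) K) (RatXY K) (MvPolynomial.X 1)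

/-- The generating function `B(x, y, t)` of Dyck N-bridges with weights `p` in `K`, where `x` and
`y` are indeterminates. -/
noncomputable def dyckB {K : Type*} [Field K] (p : Finset ℤ → K) : (RatXY K)⟦X⟧ :=
  dyckBridgeGF (fun s => algebraMap K (RatXY K) (p s)) (varX K) (varY K)

/-- The generating function `B(1, 1, t)` of unweighted Dyck N-bridges (all weights equal to `1`),
with coefficients in `K`. -/
noncomputable def dyckB11 (K : Type*) [Field K] : K⟦X⟧ := dyckBridgeGF (fun _ => 1) 1 1

open scoped RatFunc in
/-- A power series `f` in `t` over the field `L` is algebraic of degree `d` if it is algebraic over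
the field `L(t)`, with minimal polynomial over `L(t)` of degree `d`. -/
def IsAlgebraicOfDegree {L : Type*} [Field L] (f : L⟦X⟧) (d : ℕ) : Prop :=
  IsAlgebraic (RatFunc L) (HahnSeries.ofPowerSeries ℤ L f : LaurentSeries L) ∧
    (minpoly (RatFunc L) (HahnSeries.ofPowerSeries ℤ L f : LaurentSeries L)).natDegree = d

end NWalk

/-! The reachable points of a Dyck N-walk are all points of the right parity between its minimum and
its maximum. So an N-walk of even length fails to be an N-bridge exactly when its minimum is
positive or its maximum is negative, and these cases are disjoint. The minimum is the endpoint of a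
classical weighted ±1 walk, and so is the negated maximum. Hence the bridge sum at length 2m is
s^(2m) minus two positive parts of classical walk sums, where s is the total step weight
(`bridgeSum_eq`).

Prepending two steps gives a recurrence for such a positive part. Only endpoints 0 and 2 need
corrections, and these are central binomial terms (`posSum_succ`). Summing the recurrence yields
B·(1 - s²t²) = Z₁A₁ + Z₂A₂ with Zᵢ = 1/√(1 - 4cᵢt²) and explicit polynomials Aᵢ
(`dyckBridgeGF_mul`).

For indeterminate x, y the radicands 1 - 4c₁t² and 1 - 4c₂t² and their product are nonsquares in the
rational function field, so B is a sum of two square roots generating a biquadratic extension and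
has degree 4. At x = y = 1 with unit weights c₁ = c₂ = 2, the two roots merge and the degree drops
to 2.

For the asymptotics, the recurrence for the normalized number of non-bridges is run backwards, where
it contracts by 8/9; the Wallis product then estimates the central binomial coefficient. -/

namespace NWalk

/-! ### Reachable points and the criterion for N-bridges -/

/-- The smallest element of a Dyck N-step. -/
def stepMin (s : Finset ℤ) : ℤ := if -1 ∈ s then -1 else 1

/-- The largest element of a Dyck N-step. -/
def stepMax (s : Finset ℤ) : ℤ := if 1 ∈ s then 1 else -1

theorem mem_dyckNSteps {s : Finset ℤ} : s ∈ dyckNSteps ↔ s = {-1} ∨ s = {1} ∨ s = {-1, 1} := by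
  simp [dyckNSteps]

theorem mem_dyckNWalks {n : ℕ} {w : Fin n → Finset ℤ} :
    w ∈ dyckNWalks n ↔ ∀ i, w i ∈ dyckNSteps := by
  simp [dyckNWalks]

theorem nonempty_of_mem_dyckNWalks {n : ℕ} {w : Fin n → Finset ℤ} (hw : w ∈ dyckNWalks n)
    (i : Fin n) : (w i).Nonempty := by
  rcases mem_dyckNSteps.1 (mem_dyckNWalks.1 hw i) with h | h | h <;> simp [h]

theorem sum_dyckNSteps {M : Type*} [AddCommMonoid M] (f : Finset ℤ → M) :
    ∑ s ∈ dyckNSteps, f s = f {-1} + (f {1} + f {-1, 1}) := by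
  have h1 : ({-1} : Finset ℤ) ∉ ({{1}, {-1, 1}} : Finset (Finset ℤ)) := by decide
  have h2 : ({1} : Finset ℤ) ∉ ({{-1, 1}} : Finset (Finset ℤ)) := by decide
  rw [dyckNSteps, Finset.sum_insert h1, Finset.sum_insert h2, Finset.sum_singleton]

theorem sum_dyckNWalks_succ {M : Type*} [AddCommMonoid M] {n : ℕ}
    (F : (Fin (n + 1) → Finset ℤ) → M) :
    ∑ w ∈ dyckNWalks (n + 1), F w =
      ∑ s ∈ dyckNSteps, ∑ w ∈ dyckNWalks n, F (Fin.cons s w) := by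
  rw [← Finset.sum_product']
  refine Finset.sum_bij' (fun w _ => (w 0, Fin.tail w)) (fun q _ => Fin.cons q.1 q.2)
    ?_ ?_ ?_ ?_ ?_
  · intro w hw
    rw [Finset.mem_product]
    exact ⟨mem_dyckNWalks.1 hw 0, mem_dyckNWalks.2 fun i => mem_dyckNWalks.1 hw i.succ⟩
  · rintro ⟨s, w⟩ hq
    rw [Finset.mem_product] at hq
    exact mem_dyckNWalks.2 (Fin.cases hq.1 (mem_dyckNWalks.1 hq.2))
  · intro w _
    exact Fin.cons_self_tail w
  · rintro ⟨s, w⟩ _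
    simp
  · intro w _
    simp

theorem mem_reachable_cons {n : ℕ} (s : Finset ℤ) (w : Fin n → Finset ℤ) (z : ℤ) :
    z ∈ reachable (Fin.cons s w : Fin (n + 1) → Finset ℤ) ↔ ∃ a ∈ s, z - a ∈ reachable w := by
  constructor
  · rintro ⟨v, hv, rfl⟩
    refine ⟨v 0, hv 0, Fin.tail v, fun i => hv i.succ, ?_⟩
    simp [endpoint, Fin.sum_univ_succ, Fin.tail]
  · rintro ⟨a, ha, v, hv, h⟩
    refine ⟨Fin.cons a v, Fin.cases ha hv, ?_⟩
    simp only [endpoint, Fin.sum_univ_succ, Fin.cons_zero, Fin.cons_succ] at h ⊢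
    omega

/-- The reachable points of a Dyck N-walk are the points of the right parity between the two
extreme ones. -/
theorem mem_reachable_iff {n : ℕ} (w : Fin n → Finset ℤ) (hw : w ∈ dyckNWalks n) :
    ((∑ i, stepMin (w i)) ≤ ∑ i, stepMax (w i) ∧ 2 ∣ (∑ i, stepMax (w i)) - n ∧
      2 ∣ (∑ i, stepMin (w i)) - n) ∧ ∀ z, z ∈ reachable w ↔
      (∑ i, stepMin (w i)) ≤ z ∧ z ≤ ∑ i, stepMax (w i) ∧ 2 ∣ z - n := by
  -- The order and parity of the extremes belong to the induction: they ensure that, for the step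
  -- `{-1, 1}`, the two shifted progressions unite without a gap.
  induction n with
  | zero =>
    refine ⟨by simp, fun z => ?_⟩
    simp only [reachable, Compatible, endpoint, Finset.univ_eq_empty, Finset.sum_empty,
      IsEmpty.forall_iff, true_and, exists_const, Set.mem_ofPred_eq]
    omega
  | succ n ih =>
    obtain ⟨s, w, rfl⟩ : ∃ s w', w = Fin.cons s w' := ⟨w 0, Fin.tail w, (Fin.cons_self_tail w).symm⟩
    obtain ⟨⟨h1, h2, h3⟩, h4⟩ := ih w (mem_dyckNWalks.2 fun i => by
      simpa using mem_dyckNWalks.1 hw i.succ)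
    have hs : s ∈ dyckNSteps := by simpa using mem_dyckNWalks.1 hw 0
    simp only [Fin.sum_univ_succ, Fin.cons_zero, Fin.cons_succ, mem_reachable_cons, h4]
    push_cast
    rcases mem_dyckNSteps.1 hs with rfl | rfl | rfl
    · have e1 : stepMin {-1} = -1 := by decide
      have e2 : stepMax {-1} = -1 := by decide
      simp only [e1, e2, Finset.mem_singleton, exists_eq_left]
      refine ⟨by omega, fun z => by omega⟩
    · have e1 : stepMin {1} = 1 := by decide
      have e2 : stepMax {1} = 1 := by decide
      simp only [e1, e2, Finset.mem_singleton, exists_eq_left]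
      refine ⟨by omega, fun z => by omega⟩
    · have e1 : stepMin {-1, 1} = -1 := by decide
      have e2 : stepMax {-1, 1} = 1 := by decide
      simp only [e1, e2, Finset.mem_singleton, Finset.mem_insert, exists_eq_or_imp, exists_eq_left]
      refine ⟨by omega, fun z => by omega⟩

theorem minReach_eq {n : ℕ} {w : Fin n → Finset ℤ} (hw : w ∈ dyckNWalks n) :
    minReach w = ∑ i, stepMin (w i) := by
  obtain ⟨⟨h1, h2, h3⟩, h4⟩ := mem_reachable_iff w hw
  exact (isLeast_minReach w (nonempty_of_mem_dyckNWalks hw)).unique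
    ⟨(h4 _).2 ⟨le_rfl, h1, h3⟩, fun z hz => ((h4 z).1 hz).1⟩

theorem maxReach_eq {n : ℕ} {w : Fin n → Finset ℤ} (hw : w ∈ dyckNWalks n) :
    maxReach w = ∑ i, stepMax (w i) := by
  obtain ⟨⟨h1, h2, h3⟩, h4⟩ := mem_reachable_iff w hw
  exact (isGreatest_maxReach w (nonempty_of_mem_dyckNWalks hw)).unique
    ⟨(h4 _).2 ⟨h1, le_rfl, h2⟩, fun z hz => ((h4 z).1 hz).2.1⟩

theorem isNBridge_iff {n : ℕ} {w : Fin n → Finset ℤ} (hw : w ∈ dyckNWalks n) :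
    IsNBridge w ↔ (∑ i, stepMin (w i)) ≤ 0 ∧ 0 ≤ ∑ i, stepMax (w i) ∧ Even n := by
  have h := (mem_reachable_iff w hw).2 0
  rw [show IsNBridge w ↔ 0 ∈ reachable w from Iff.rfl, h, ← Int.even_coe_nat, even_iff_two_dvd]
  simp

/-! ### Weighted sums over classical ±1 walks -/

/-- The sum over all Dyck N-walks `w` of the weights `∏ ω (w i)` times `f` at the endpoint of the
classical walk with steps `σ (w i)`. -/
noncomputable def walkSum {L : Type*} [CommRing L] (ω : Finset ℤ → L) (σ : Finset ℤ → ℤ) (n : ℕ)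
    (f : ℤ → L) : L :=
  ∑ w ∈ dyckNWalks n, (∏ i, ω (w i)) * f (∑ i, σ (w i))

section walkSum

variable {L : Type*} [CommRing L] (ω : Finset ℤ → L) (σ : Finset ℤ → ℤ)

theorem walkSum_succ (n : ℕ) (f : ℤ → L) :
    walkSum ω σ (n + 1) f = ∑ s ∈ dyckNSteps, ω s * walkSum ω σ n fun k => f (σ s + k) := by
  simp only [walkSum, sum_dyckNWalks_succ, Fin.prod_univ_succ, Fin.sum_univ_succ, Fin.cons_zero,
    Fin.cons_succ, Finset.mul_sum, mul_assoc]

/-- If the steps `σ` are `1` and `-1` with total weights `β` and `α`, the weighted sum over walks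
is given by the binomial formula. -/
theorem walkSum_eq {α β : L}
    (h : ∀ g : ℤ → L, ∑ s ∈ dyckNSteps, ω s * g (σ s) = α * g (-1) + β * g 1) (n : ℕ)
    (f : ℤ → L) :
    walkSum ω σ n f = ∑ ij ∈ Finset.HasAntidiagonal.antidiagonal n,
      (n.choose ij.1 : L) * (β ^ ij.1 * α ^ ij.2 * f (ij.1 - ij.2)) := by
  induction n generalizing f with
  | zero => simp [walkSum, dyckNWalks]
  | succ n ih =>
    rw [walkSum_succ, h fun a => walkSum ω σ n fun k => f (a + k), ih, ih,
      Finset.sum_antidiagonal_choose_succ_mul (fun i j => β ^ i * α ^ j * f ((i : ℤ) - j)),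
      Finset.mul_sum, Finset.mul_sum]
    congr 1
    · refine Finset.sum_congr rfl fun ij _ => ?_
      rw [show (ij.1 : ℤ) - ((ij.2 + 1 : ℕ) : ℤ) = -1 + (ij.1 - ij.2) by push_cast; ring]
      ring
    · refine Finset.sum_congr rfl fun ij hij => ?_
      rw [show ((ij.1 + 1 : ℕ) : ℤ) - ij.2 = 1 + (ij.1 - ij.2) by push_cast; ring,
        Nat.choose_symm_of_eq_add (Finset.HasAntidiagonal.mem_antidiagonal.1 hij).symm]
      ring

end walkSum

/-! ### The positive part and its two-step recurrence -/

section positivePart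

variable {L : Type*} [Field L] (ω : Finset ℤ → L) (σ : Finset ℤ → ℤ) {α β : L}

theorem walkSum_congr_even
    (h : ∀ g : ℤ → L, ∑ s ∈ dyckNSteps, ω s * g (σ s) = α * g (-1) + β * g 1) (m : ℕ)
    {f g : ℤ → L} (hfg : ∀ k, Even k → f k = g k) :
    walkSum ω σ (2 * m) f = walkSum ω σ (2 * m) g := by
  rw [walkSum_eq ω σ h, walkSum_eq ω σ h]
  refine Finset.sum_congr rfl fun ij hij => ?_
  have := Finset.HasAntidiagonal.mem_antidiagonal.1 hij
  rw [hfg _ ⟨m - ij.2, by omega⟩]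

theorem walkSum_add (n : ℕ) (f g : ℤ → L) :
    walkSum ω σ n (fun k => f k + g k) = walkSum ω σ n f + walkSum ω σ n g := by
  simp only [walkSum, mul_add, Finset.sum_add_distrib]

theorem walkSum_const_mul (n : ℕ) (a : L) (f : ℤ → L) :
    walkSum ω σ n (fun k => a * f k) = a * walkSum ω σ n f := by
  simp only [walkSum, Finset.mul_sum]
  exact Finset.sum_congr rfl fun _ _ => by ring

theorem walkSum_zero_indicator
    (h : ∀ g : ℤ → L, ∑ s ∈ dyckNSteps, ω s * g (σ s) = α * g (-1) + β * g 1) (m : ℕ) :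
    walkSum ω σ (2 * m) (fun k => if k = 0 then 1 else 0) = m.centralBinom * (α * β) ^ m := by
  rw [walkSum_eq ω σ h, Finset.sum_eq_single (m, m)]
  · simp [Nat.centralBinom, mul_pow, mul_comm]
  · rintro ⟨i, j⟩ hij hne
    have := Finset.HasAntidiagonal.mem_antidiagonal.1 hij
    have h2 : ¬ ((i : ℤ) - j = 0) := fun h0 => hne (Prod.ext (by simp at this ⊢; omega)
      (by simp at this ⊢; omega))
    simp [h2]
  · intro hm
    exact absurd (Finset.HasAntidiagonal.mem_antidiagonal.2 (by simp; omega)) hm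

/-- Endpoint 2 needs m + 1 up steps and m - 1 down steps; the factor α² balances the exponents,
without division and with m = 0 included. -/
theorem walkSum_two_indicator
    (h : ∀ g : ℤ → L, ∑ s ∈ dyckNSteps, ω s * g (σ s) = α * g (-1) + β * g 1) (m : ℕ) :
    α ^ 2 * walkSum ω σ (2 * m) (fun k => if k = 2 then 1 else 0) =
      ((2 * m).choose (m + 1) : L) * (α * β) ^ (m + 1) := by
  rw [walkSum_eq ω σ h]
  rcases m with - | m
  · simp
  rw [Finset.sum_eq_single (m + 2, m)]
  · simp only [show ((m + 2 : ℕ) : ℤ) - m = 2 by push_cast; ring, if_true]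
    ring
  · rintro ⟨i, j⟩ hij hne
    have := Finset.HasAntidiagonal.mem_antidiagonal.1 hij
    have h2 : ¬ ((i : ℤ) - j = 2) := fun h0 => hne (Prod.ext (by simp at this ⊢; omega)
      (by simp at this ⊢; omega))
    simp [h2]
  · intro hm
    exact absurd (Finset.HasAntidiagonal.mem_antidiagonal.2 (by simp; omega)) hm

theorem two_mul_choose_succ (m : ℕ) :
    2 * ((2 * m).choose (m + 1)) + 2 * m.centralBinom = (m + 1).centralBinom := by
  have e : (m + 1) + m = 2 * m + 1 := by ring
  have h1 := Nat.choose_symm_of_eq_add e.symm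
  have h2 : (2 * m + 1).choose (m + 1) = (2 * m).choose m + (2 * m).choose (m + 1) :=
    Nat.choose_succ_succ _ _
  have h3 : (2 * m + 1 + 1).choose (m + 1) = (2 * m + 1).choose m + (2 * m + 1).choose (m + 1) :=
    Nat.choose_succ_succ _ _
  rw [Nat.centralBinom, Nat.centralBinom, show 2 * (m + 1) = 2 * m + 1 + 1 by ring]
  omega

/-- The contribution of the walks of length `2 * m` with positive endpoint. -/
noncomputable def posSum (x : L) (m : ℕ) : L :=
  walkSum ω σ (2 * m) fun k => if 0 < k then x ^ k else 0

theorem posSum_zero (x : L) : posSum ω σ x 0 = 0 := by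
  simp [posSum, walkSum]

/-- Two prepended steps multiply the positive part by (α/x + βx)², except near the boundary: after
two down steps endpoint 2 is lost, after two up steps endpoint 0 is gained. A mixed pair changes
nothing. -/
theorem posSum_succ
    (h : ∀ g : ℤ → L, ∑ s ∈ dyckNSteps, ω s * g (σ s) = α * g (-1) + β * g 1) {x : L} (hx : x ≠ 0)
    (m : ℕ) :
    2 * posSum ω σ x (m + 1) = 2 * (α * x⁻¹ + β * x) ^ 2 * posSum ω σ x m +
      (2 * m.centralBinom - (m + 1).centralBinom) * (α * β) ^ (m + 1) +
      2 * (β * x) ^ 2 * (m.centralBinom * (α * β) ^ m) := by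
  have key : posSum ω σ x (m + 1) =
      α ^ 2 * (x⁻¹ ^ 2 * posSum ω σ x m +
        -1 * walkSum ω σ (2 * m) fun k => if k = 2 then 1 else 0) +
      2 * (α * β) * posSum ω σ x m +
      β ^ 2 * (x ^ 2 * posSum ω σ x m +
        x ^ 2 * walkSum ω σ (2 * m) fun k => if k = 0 then 1 else 0) := by
    have e1 : walkSum ω σ (2 * m) (fun k => if 0 < -1 + (-1 + k) then x ^ (-1 + (-1 + k)) else 0) =
        x⁻¹ ^ 2 * posSum ω σ x m +
          -1 * walkSum ω σ (2 * m) fun k => if k = 2 then 1 else 0 := by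
      rw [posSum, ← walkSum_const_mul, ← walkSum_const_mul, ← walkSum_add]
      refine walkSum_congr_even ω σ h m ?_
      rintro k ⟨j, rfl⟩
      rcases lt_trichotomy j 1 with hj | rfl | hj
      · rw [if_neg (by omega), if_neg (by omega), if_neg (by omega)]; ring
      · simp only [if_neg (show ¬ (0 : ℤ) < -1 + (-1 + (1 + 1)) by omega),
          if_pos (show (0 : ℤ) < 1 + 1 by omega), if_pos (show (1 : ℤ) + 1 = 2 by omega)]
        rw [show (1 : ℤ) + 1 = (2 : ℕ) by norm_num, zpow_natCast]
        field_simp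
        ring
      · rw [if_pos (by omega), if_pos (by omega), if_neg (by omega),
          show -1 + (-1 + (j + j)) = (j + j) - (2 : ℕ) by push_cast; ring, zpow_sub₀ hx,
          zpow_natCast]
        field_simp
        ring
    have e2 : walkSum ω σ (2 * m) (fun k => if 0 < 1 + (1 + k) then x ^ (1 + (1 + k)) else 0) =
        x ^ 2 * posSum ω σ x m +
          x ^ 2 * walkSum ω σ (2 * m) fun k => if k = 0 then 1 else 0 := by
      rw [posSum, ← walkSum_const_mul, ← walkSum_const_mul, ← walkSum_add]
      refine walkSum_congr_even ω σ h m ?_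
      rintro k ⟨j, rfl⟩
      rcases lt_trichotomy j 0 with hj | rfl | hj
      · rw [if_neg (by omega), if_neg (by omega), if_neg (by omega)]; ring
      · simp only [add_zero, lt_irrefl, if_false, if_true]
        rw [if_pos (by omega), show (1 : ℤ) + 1 = (2 : ℕ) by norm_num, zpow_natCast]
        ring
      · rw [if_pos (by omega), if_pos (by omega), if_neg (by omega),
          show 1 + (1 + (j + j)) = (j + j) + (2 : ℕ) by push_cast; ring, zpow_add₀ hx,
          zpow_natCast]
        ring
    have e3 (k : ℤ) : -1 + (1 + k) = k := by ring
    have e4 (k : ℤ) : 1 + (-1 + k) = k := by ring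
    conv_lhs => rw [posSum, show 2 * (m + 1) = 2 * m + 1 + 1 by ring]
    simp only [walkSum_succ]
    rw [h fun a => ∑ s ∈ dyckNSteps, ω s * walkSum ω σ (2 * m) fun k =>
        if 0 < a + (σ s + k) then x ^ (a + (σ s + k)) else 0,
      h fun a => walkSum ω σ (2 * m) fun k =>
        if 0 < -1 + (a + k) then x ^ (-1 + (a + k)) else 0,
      h fun a => walkSum ω σ (2 * m) fun k =>
        if 0 < 1 + (a + k) then x ^ (1 + (a + k)) else 0, e1, e2]
    simp only [e3, e4]
    change _ * (_ + _ * posSum ω σ x m) + _ * (_ * posSum ω σ x m + _) = _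
    ring
  -- Rewrites the endpoint-2 count through central binomials, so that a single kind of series
  -- appears later.
  have hc : (2 * ((2 * m).choose (m + 1)) + 2 * m.centralBinom : L) = (m + 1).centralBinom := by
    exact_mod_cast congrArg (Nat.cast (R := L)) (two_mul_choose_succ m)
  have h2 := walkSum_two_indicator ω σ h m
  rw [key, walkSum_zero_indicator ω σ h, ← hc]
  have hxx : x⁻¹ * x = 1 := inv_mul_cancel₀ hx
  linear_combination (-2) * h2 - 4 * α * β * posSum ω σ x m * hxx

end positivePart

/-! ### N-bridges as the complement of two positive parts -/

theorem prod_zpow_const {L ι : Type*} [Field L] {x : L} (hx : x ≠ 0) (s : Finset ι) (f : ι → ℤ) :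
    ∏ i ∈ s, x ^ f i = x ^ ∑ i ∈ s, f i := by
  classical
  induction s using Finset.induction_on with
  | empty => simp
  | insert a s ha ih => rw [Finset.prod_insert ha, Finset.sum_insert ha, ih, zpow_add₀ hx]

theorem stepMin_le_stepMax {s : Finset ℤ} (hs : s ∈ dyckNSteps) : stepMin s ≤ stepMax s := by
  rcases mem_dyckNSteps.1 hs with rfl | rfl | rfl <;> decide

section bridgeSum

variable {L : Type*} [Field L] (p : Finset ℤ → L) {x y : L}

/-- The total weight of the Dyck N-steps. -/
noncomputable def stepWeight (p : Finset ℤ → L) (x y : L) : L :=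
  p {-1} * x⁻¹ * y⁻¹ + (p {1} * x * y + p {-1, 1} * x⁻¹ * y)

/-- The weighted sum over the Dyck N-bridges of length `2 * m`. -/
noncomputable def bridgeSum (p : Finset ℤ → L) (x y : L) (m : ℕ) : L :=
  ∑ w ∈ dyckNBridges (2 * m), (∏ i, p (w i)) * x ^ minReach w * y ^ maxReach w

theorem sum_dyckNSteps_stepMin (g : ℤ → L) :
    ∑ s ∈ dyckNSteps, (p s * y ^ stepMax s) * g (stepMin s) =
      (p {-1} * y⁻¹ + p {-1, 1} * y) * g (-1) + (p {1} * y) * g 1 := by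
  rw [sum_dyckNSteps, show stepMin {-1} = -1 by decide, show stepMax {-1} = -1 by decide,
    show stepMin {1} = 1 by decide, show stepMax {1} = 1 by decide,
    show stepMin {-1, 1} = -1 by decide, show stepMax {-1, 1} = 1 by decide, zpow_neg_one, zpow_one]
  ring

/-- The sign turns a negative maximum into a positive endpoint, so the same positive part applies,
with y⁻¹ as its variable. -/
theorem sum_dyckNSteps_stepMax (g : ℤ → L) :
    ∑ s ∈ dyckNSteps, (p s * x ^ stepMin s) * g (-stepMax s) =
      (p {1} * x + p {-1, 1} * x⁻¹) * g (-1) + (p {-1} * x⁻¹) * g 1 := by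
  rw [sum_dyckNSteps, show stepMin {-1} = -1 by decide, show stepMax {-1} = -1 by decide,
    show stepMin {1} = 1 by decide, show stepMax {1} = 1 by decide,
    show stepMin {-1, 1} = -1 by decide, show stepMax {-1, 1} = 1 by decide, zpow_neg_one, zpow_one,
    neg_neg]
  ring

theorem sum_dyckNWalks_eq (hx : x ≠ 0) (hy : y ≠ 0) (n : ℕ) :
    ∑ w ∈ dyckNWalks n, (∏ i, p (w i)) * x ^ (∑ i, stepMin (w i)) * y ^ (∑ i, stepMax (w i)) =
      stepWeight p x y ^ n := by
  have h : stepWeight p x y = ∑ s ∈ dyckNSteps, p s * x ^ stepMin s * y ^ stepMax s := by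
    rw [sum_dyckNSteps, show stepMin {-1} = -1 by decide, show stepMax {-1} = -1 by decide,
      show stepMin {1} = 1 by decide, show stepMax {1} = 1 by decide,
      show stepMin {-1, 1} = -1 by decide, show stepMax {-1, 1} = 1 by decide, zpow_neg_one,
      zpow_neg_one, zpow_one, zpow_one, stepWeight]
  have h2 := Finset.prod_univ_sum (fun _ : Fin n => dyckNSteps)
    fun _ s => p s * x ^ stepMin s * y ^ stepMax s
  rw [← h, Finset.prod_const, Finset.card_univ, Fintype.card_fin] at h2
  rw [h2, dyckNWalks]
  refine Finset.sum_congr rfl fun w _ => ?_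
  rw [Finset.prod_mul_distrib, Finset.prod_mul_distrib, prod_zpow_const hx, prod_zpow_const hy]

/-- Minimum positive and maximum negative exclude each other, so both contributions are subtracted
without overlap. -/
theorem bridgeSum_eq (hx : x ≠ 0) (hy : y ≠ 0) (m : ℕ) :
    bridgeSum p x y m = stepWeight p x y ^ (2 * m) -
      posSum (fun s => p s * y ^ stepMax s) stepMin x m -
      posSum (fun s => p s * x ^ stepMin s) (fun s => -stepMax s) y⁻¹ m := by
  rw [← sum_dyckNWalks_eq p hx hy, posSum, posSum, walkSum, walkSum, ← Finset.sum_sub_distrib,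
    ← Finset.sum_sub_distrib, bridgeSum, dyckNBridges, Finset.sum_filter]
  refine Finset.sum_congr rfl fun w hw => ?_
  have hle : ∑ i, stepMin (w i) ≤ ∑ i, stepMax (w i) :=
    Finset.sum_le_sum fun i _ => stepMin_le_stepMax (mem_dyckNWalks.1 hw i)
  rw [minReach_eq hw, maxReach_eq hw, Finset.prod_mul_distrib, Finset.prod_mul_distrib,
    prod_zpow_const hx, prod_zpow_const hy, Finset.sum_neg_distrib, inv_zpow', neg_neg]
  simp only [isNBridge_iff hw, even_two_mul, and_true]
  by_cases h1 : 0 < ∑ i, stepMin (w i)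
  · rw [if_neg (by omega), if_pos h1, if_neg (by omega)]
    ring
  · by_cases h2 : 0 < -∑ i, stepMax (w i)
    · rw [if_neg (by omega), if_neg h1, if_pos h2]
      ring
    · rw [if_pos (by omega), if_neg h1, if_neg h2]
      ring

theorem bridgeSum_zero (hx : x ≠ 0) (hy : y ≠ 0) : bridgeSum p x y 0 = 1 := by
  rw [bridgeSum_eq p hx hy, posSum_zero, posSum_zero]
  simp

theorem bridgeSum_succ (hx : x ≠ 0) (hy : y ≠ 0) (m : ℕ) :
    2 * bridgeSum p x y (m + 1) = 2 * stepWeight p x y ^ 2 * bridgeSum p x y m +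
      ((m + 1).centralBinom * (p {1} * (p {-1} + p {-1, 1} * y ^ 2)) ^ (m + 1) -
        2 * (p {1} * x * y * stepWeight p x y) *
          (m.centralBinom * (p {1} * (p {-1} + p {-1, 1} * y ^ 2)) ^ m)) +
      ((m + 1).centralBinom * (p {-1} * (p {1} + p {-1, 1} * x⁻¹ ^ 2)) ^ (m + 1) -
        2 * (p {-1} * x⁻¹ * y⁻¹ * stepWeight p x y) *
          (m.centralBinom * (p {-1} * (p {1} + p {-1, 1} * x⁻¹ ^ 2)) ^ m)) := by
  have h1 := posSum_succ _ _ (sum_dyckNSteps_stepMin p (y := y)) hx m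
  have h2 := posSum_succ _ (fun s => -stepMax s) (sum_dyckNSteps_stepMax p (x := x))
    (inv_ne_zero hy) m
  have c1 : (p {-1} * y⁻¹ + p {-1, 1} * y) * (p {1} * y) =
      p {1} * (p {-1} + p {-1, 1} * y ^ 2) := by field_simp
  have c2 : (p {1} * x + p {-1, 1} * x⁻¹) * (p {-1} * x⁻¹) =
      p {-1} * (p {1} + p {-1, 1} * x⁻¹ ^ 2) := by field_simp
  have s1 : (p {-1} * y⁻¹ + p {-1, 1} * y) * x⁻¹ + p {1} * y * x = stepWeight p x y := by
    rw [stepWeight]; ring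
  have s2 : (p {1} * x + p {-1, 1} * x⁻¹) * y⁻¹⁻¹ + p {-1} * x⁻¹ * y⁻¹ = stepWeight p x y := by
    rw [stepWeight, inv_inv]; ring
  -- With α, β the down and up weights, this is βx(α/x + βx) = (βx)² + αβ, which gathers the two
  -- corrections with central binomial m into one.
  have b1 : p {1} * x * y * stepWeight p x y =
      (p {1} * y * x) ^ 2 + p {1} * (p {-1} + p {-1, 1} * y ^ 2) := by
    rw [stepWeight]; field_simp; ring
  have b2 : p {-1} * x⁻¹ * y⁻¹ * stepWeight p x y =
      (p {-1} * x⁻¹ * y⁻¹) ^ 2 + p {-1} * (p {1} + p {-1, 1} * x⁻¹ ^ 2) := by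
    rw [stepWeight]; field_simp
  rw [c1, s1] at h1
  rw [c2, s2] at h2
  rw [b1, b2, bridgeSum_eq p hx hy, bridgeSum_eq p hx hy, mul_sub, mul_sub, h1, h2]
  ring

open Classical in
theorem dyckBridgeGF_eq_expand (x y : L) :
    dyckBridgeGF p x y = PowerSeries.expand 2 two_ne_zero (PowerSeries.mk (bridgeSum p x y)) := by
  ext n
  rw [dyckBridgeGF, PowerSeries.coeff_mk]
  rcases Nat.even_or_odd' n with ⟨m, rfl | rfl⟩
  · rw [PowerSeries.coeff_expand_mul, PowerSeries.coeff_mk, bridgeSum]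
  · rw [PowerSeries.coeff_expand_of_not_dvd _ _ _ (by omega), dyckNBridges, Finset.filter_false_of_mem,
      Finset.sum_empty]
    intro w hw h
    have := ((isNBridge_iff hw).1 h).2.2
    rw [Nat.even_iff] at this
    omega

end bridgeSum

/-! ### Central binomial series and the functional equation -/

/-- The power series `∑ binom(2m, m) c ^ m t ^ m = 1 / √(1 - 4ct)`. -/
noncomputable def centralBinomSeries {L : Type*} [Field L] (c : L) : L⟦X⟧ :=
  PowerSeries.mk fun m => m.centralBinom * c ^ m

section centralBinomSeries

open PowerSeries

variable {L : Type*} [Field L]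

theorem constantCoeff_centralBinomSeries (c : L) : constantCoeff (centralBinomSeries c) = 1 := by
  rw [← coeff_zero_eq_constantCoeff_apply, centralBinomSeries, coeff_mk]
  simp

/-- The binomial recurrence is the equation Z'(1 - 4ct) = 2cZ. It makes the derivative of Z²(1 -
4ct) vanish, and in characteristic 0 the constant term then decides. -/
theorem centralBinomSeries_sq [CharZero L] (c : L) :
    centralBinomSeries c ^ 2 * (1 - C (4 * c) * X) = 1 := by
  have key : d⁄dX L (centralBinomSeries c) * (1 - C (4 * c) * X) =
      C (2 * c) * centralBinomSeries c := by
    ext n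
    have h (n : ℕ) : ((n + 1 : L) * (n + 1).centralBinom) = 2 * (2 * n + 1) * n.centralBinom := by
      exact_mod_cast congrArg (Nat.cast (R := L)) (Nat.succ_mul_centralBinom_succ n)
    rw [mul_sub, mul_one, map_sub, mul_left_comm, coeff_C_mul, coeff_C_mul]
    rcases n with - | n
    · have := h 0
      simp only [Nat.cast_zero, zero_add, mul_zero, Nat.centralBinom_zero, Nat.cast_one] at this
      simp only [centralBinomSeries, coeff_derivative, coeff_mk, coeff_zero_mul_X,
        Nat.centralBinom_zero, Nat.cast_zero, zero_add, Nat.cast_one, pow_zero, pow_one]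
      linear_combination c * this
    · rw [coeff_succ_mul_X, coeff_derivative, coeff_derivative]
      simp only [centralBinomSeries, coeff_mk]
      have h1 := h (n + 1)
      push_cast at h1 ⊢
      linear_combination c ^ (n + 2) * h1
  refine derivative.ext ?_ ?_
  · simp only [Derivation.leibniz, Derivation.leibniz_pow, map_sub, derivative_C,
      Derivation.map_one_eq_zero,
      derivative_X, smul_eq_mul, nsmul_eq_mul]
    have h4 : (C (4 * c) : L⟦X⟧) = 2 * C (2 * c) := by
      rw [show 4 * c = 2 * (2 * c) by ring, map_mul, map_ofNat]
    rw [h4] at key ⊢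
    push_cast
    linear_combination 2 * centralBinomSeries c * key
  · simp [constantCoeff_centralBinomSeries]

theorem mk_bridgeSum_mul [CharZero L] (p : Finset ℤ → L) {x y : L} (hx : x ≠ 0) (hy : y ≠ 0) :
    PowerSeries.mk (bridgeSum p x y) * (1 - C (stepWeight p x y ^ 2) * X) =
      centralBinomSeries (p {1} * (p {-1} + p {-1, 1} * y ^ 2)) *
        (C (1 / 2) - C (p {1} * x * y * stepWeight p x y) * X) +
      centralBinomSeries (p {-1} * (p {1} + p {-1, 1} * x⁻¹ ^ 2)) *
        (C (1 / 2) - C (p {-1} * x⁻¹ * y⁻¹ * stepWeight p x y) * X) := by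
  ext n
  simp only [mul_sub, mul_one, map_sub, map_add, ← mul_assoc, mul_comm _ (C _)]
  rcases n with - | n
  · simp [constantCoeff_centralBinomSeries, bridgeSum_zero p hx hy]
    norm_num
  · simp only [coeff_succ_mul_X, coeff_C_mul]
    simp only [centralBinomSeries, coeff_mk]
    linear_combination (1 / 2) * bridgeSum_succ p hx hy n

/-- The power series `∑ binom(2m, m) c ^ m t ^ (2m) = 1 / √(1 - 4ct²)`. -/
noncomputable def evenCentralBinomSeries (c : L) : L⟦X⟧ :=
  expand 2 two_ne_zero (centralBinomSeries c)

theorem constantCoeff_evenCentralBinomSeries (c : L) :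
    constantCoeff (evenCentralBinomSeries c) = 1 := by
  rw [evenCentralBinomSeries, constantCoeff_expand, constantCoeff_centralBinomSeries]

theorem evenCentralBinomSeries_sq [CharZero L] (c : L) :
    evenCentralBinomSeries c ^ 2 * (1 - C (4 * c) * X ^ 2) = 1 := by
  have := congrArg (expand 2 two_ne_zero) (centralBinomSeries_sq c)
  simpa only [evenCentralBinomSeries, map_mul, map_pow, map_sub, map_one, expand_C, expand_X]
    using this

/-- The algebraic expression of the generating function of Dyck N-bridges. -/
theorem dyckBridgeGF_mul [CharZero L] (p : Finset ℤ → L) {x y : L} (hx : x ≠ 0) (hy : y ≠ 0) :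
    dyckBridgeGF p x y * (1 - C (stepWeight p x y ^ 2) * X ^ 2) =
      evenCentralBinomSeries (p {1} * (p {-1} + p {-1, 1} * y ^ 2)) *
        (C (1 / 2) - C (p {1} * x * y * stepWeight p x y) * X ^ 2) +
      evenCentralBinomSeries (p {-1} * (p {1} + p {-1, 1} * x⁻¹ ^ 2)) *
        (C (1 / 2) - C (p {-1} * x⁻¹ * y⁻¹ * stepWeight p x y) * X ^ 2) := by
  have := congrArg (expand 2 two_ne_zero) (mk_bridgeSum_mul p hx hy)
  rw [dyckBridgeGF_eq_expand]
  simpa only [evenCentralBinomSeries, map_mul, map_sub, map_add, map_one, expand_C, expand_X]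
    using this

end centralBinomSeries

/-! ### Degrees of square roots and of sums of two square roots -/

section degree

open Polynomial

variable {F E : Type*} [Field F] [Field E] [Algebra F E]

theorem natDegree_minpoly_of_sq {u : E} {e : F} (he : ¬ IsSquare e) (hu : u ^ 2 = algebraMap F E e) :
    IsIntegral F u ∧ (minpoly F u).natDegree = 2 := by
  have hmonic : (X ^ 2 - C e : F[X]).Monic := monic_X_pow_sub_C e two_ne_zero
  have hroot : aeval u (X ^ 2 - C e : F[X]) = 0 := by simp [hu]
  have hint : IsIntegral F u := ⟨_, hmonic, by rwa [← aeval_def]⟩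
  refine ⟨hint, le_antisymm ?_ ((minpoly.two_le_natDegree_iff hint).2 ?_)⟩
  · have := minpoly.min F u hmonic hroot
    rw [← natDegree_X_pow_sub_C (n := 2) (r := e)]
    exact natDegree_le_natDegree this
  · rintro ⟨r, rfl⟩
    refine he ⟨r, (algebraMap F E).injective ?_⟩
    rw [← hu, map_mul, sq]

theorem eq_zero_of_sq_basis {u : E} {e : F} (he : ¬ IsSquare e) (hu : u ^ 2 = algebraMap F E e)
    {a b : F} (h : algebraMap F E a + algebraMap F E b * u = 0) : a = 0 ∧ b = 0 := by
  have hb : b = 0 := by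
    by_contra hb
    refine he ⟨a / b, (algebraMap F E).injective ?_⟩
    have hb' : algebraMap F E b ≠ 0 := by simpa using hb
    have hu' : u = -(algebraMap F E a / algebraMap F E b) := by
      field_simp
      linear_combination h
    rw [← hu, hu', map_mul, map_div₀]
    ring
  subst hb
  simpa using h

/-- A relation that involves v puts v in F(u), say v = f + gu. Squaring forces fg = 0, so e = f² or
e = g²d, and e or de is a square. -/
theorem eq_zero_of_biquadratic_basis {u v : E} {d e : F} (h2 : (2 : F) ≠ 0) (hd : ¬ IsSquare d)
    (he : ¬ IsSquare e) (hde : ¬ IsSquare (d * e)) (hu : u ^ 2 = algebraMap F E d)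
    (hv : v ^ 2 = algebraMap F E e) {a b r s : F}
    (h : algebraMap F E a + algebraMap F E b * u +
      (algebraMap F E r + algebraMap F E s * u) * v = 0) : a = 0 ∧ b = 0 ∧ r = 0 ∧ s = 0 := by
  set ι := algebraMap F E with hι
  by_cases hrs : ι r + ι s * u = 0
  · rw [hrs, zero_mul, add_zero] at h
    obtain ⟨h3, h4⟩ := eq_zero_of_sq_basis hd hu hrs
    obtain ⟨h5, h6⟩ := eq_zero_of_sq_basis hd hu h
    exact ⟨h5, h6, h3, h4⟩
  exfalso
  -- The norm of r + su, the denominator when solving for v.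
  have hN : r ^ 2 - s ^ 2 * d ≠ 0 := by
    intro hN
    by_cases hs : s = 0
    · subst hs
      have hr : r = 0 := by simpa using hN
      subst hr
      simp at hrs
    · refine hd ⟨r / s, ?_⟩
      field_simp
      linear_combination -hN
  -- `v = f + g u` with `f, g` in the base field
  obtain ⟨f, g, hfg⟩ : ∃ f g : F, v = ι f + ι g * u := by
    refine ⟨-(a * r - b * s * d) / (r ^ 2 - s ^ 2 * d), -(b * r - a * s) / (r ^ 2 - s ^ 2 * d), ?_⟩
    have hN' : ι r ^ 2 - ι s ^ 2 * ι d ≠ 0 := by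
      rw [← map_pow, ← map_pow, ← map_mul, ← map_sub]
      exact (map_ne_zero ι).2 hN
    simp only [map_div₀, map_neg, map_sub, map_mul, map_pow]
    field_simp
    rw [← hu] at hN' ⊢
    linear_combination (ι r - ι s * u) * h
  have h3 : ι (f ^ 2 + g ^ 2 * d - e) + ι (2 * f * g) * u = 0 := by
    simp only [map_add, map_sub, map_mul, map_pow, map_ofNat, ← hu, ← hv, hfg]
    ring
  obtain ⟨h4, h5⟩ := eq_zero_of_sq_basis hd hu h3
  rcases mul_eq_zero.1 h5 with h6 | h6
  · have hf : f = 0 := by simpa [h2] using h6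
    subst hf
    exact hde ⟨g * d, by linear_combination -d * h4⟩
  · subst h6
    exact he ⟨f, by linear_combination -h4⟩

theorem natDegree_minpoly_of_biquadratic {u v : E} {d e : F} (h2 : (2 : F) ≠ 0)
    (hd : ¬ IsSquare d) (he : ¬ IsSquare e) (hde : ¬ IsSquare (d * e))
    (hu : u ^ 2 = algebraMap F E d) (hv : v ^ 2 = algebraMap F E e) :
    IsIntegral F (u + v) ∧ (minpoly F (u + v)).natDegree = 4 := by
  set P : F[X] := X ^ 4 + C (-2 * (d + e)) * X ^ 2 + C ((d - e) ^ 2) with hP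
  have hdeg : P.natDegree = 4 := by rw [hP]; compute_degree!
  have hmonic : P.Monic := by rw [hP]; monicity!
  have hroot : aeval (u + v) P = 0 := by
    simp only [hP, map_add, map_mul, map_pow, aeval_X, aeval_C, map_sub, map_neg, map_ofNat,
      ← hu, ← hv]
    ring
  have hint : IsIntegral F (u + v) := ⟨_, hmonic, by rwa [← aeval_def]⟩
  refine ⟨hint, le_antisymm ?_ ?_⟩
  · rw [← hdeg]
    exact natDegree_le_natDegree (minpoly.min F _ hmonic hroot)
  · by_contra! hlt
    have h0 := minpoly.aeval F (u + v)
    rw [aeval_eq_sum_range' hlt] at h0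
    set c := (minpoly F (u + v)).coeff with hc
    simp only [Finset.sum_range_succ, Finset.sum_range_zero, Algebra.smul_def] at h0
    have hde' : d - e ≠ 0 := fun h => hde ⟨e, by linear_combination e * h⟩
    -- Coordinates of c₀ + c₁(u + v) + c₂(u + v)² + c₃(u + v)³ on 1, u, v, uv, from (u + v)² = d + e
    -- + 2uv and (u + v)³ = (d + 3e)u + (3d + e)v.
    obtain ⟨e0, e1, e2, e3⟩ := eq_zero_of_biquadratic_basis h2 hd he hde hu hv
      (a := c 0 + c 2 * (d + e)) (b := c 1 + c 3 * (d + 3 * e)) (r := c 1 + c 3 * (3 * d + e))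
      (s := 2 * c 2) (by
        simp only [map_add, map_mul, map_ofNat, ← hu, ← hv]
        linear_combination h0)
    have c2 : c 2 = 0 := by simpa [h2] using e3
    have c3 : c 3 = 0 := by
      have : c 3 * (2 * (d - e)) = 0 := by linear_combination e2 - e1
      simpa [h2, hde'] using this
    have c0 : c 0 = 0 := by simpa [c2] using e0
    have c1 : c 1 = 0 := by simpa [c3] using e1
    refine minpoly.ne_zero hint (Polynomial.ext fun n => ?_)
    rw [coeff_zero]
    rcases lt_or_ge n 4 with hn | hn
    · interval_cases n <;> assumption
    · exact coeff_eq_zero_of_natDegree_lt (hlt.trans_le hn)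

end degree

/-! ### Squares among polynomials and rational functions -/

section square

open Polynomial

variable {L : Type*} [Field L]

theorem isSquare_of_isSquare_ratFunc {P : L[X]} (h : IsSquare (algebraMap L[X] (RatFunc L) P)) :
    IsSquare P := by
  obtain ⟨g, hg⟩ := h
  obtain ⟨Q, rfl⟩ := IsIntegrallyClosed.exists_algebraMap_eq_of_isIntegral_pow (R := L[X]) (x := g)
    two_pos (by rw [sq, ← hg]; exact isIntegral_algebraMap)
  refine ⟨Q, IsFractionRing.injective L[X] (RatFunc L) ?_⟩
  rw [hg, map_mul]

theorem eq_of_isSquare_mul {γ δ : L} (h2 : (2 : L) ≠ 0)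
    (h : IsSquare ((1 - C γ * X ^ 2) * (1 - C δ * X ^ 2) : L[X])) : γ = δ := by
  obtain ⟨Q, hQ⟩ := h
  have hd : ((1 - C γ * X ^ 2) * (1 - C δ * X ^ 2) : L[X]).natDegree ≤ 4 := by
    compute_degree
  have hQd : Q.natDegree < 3 := by
    rw [hQ, ← sq, natDegree_pow] at hd
    omega
  obtain ⟨a, b, c, rfl⟩ : ∃ a b c : L, Q = C a + C b * X + C c * X ^ 2 := by
    refine ⟨Q.coeff 0, Q.coeff 1, Q.coeff 2, ?_⟩
    conv_lhs => rw [Q.as_sum_range_C_mul_X_pow' hQd]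
    simp [Finset.sum_range_succ]
  have hexp : (C (a ^ 2 - 1) + C (2 * a * b) * X + C (b ^ 2 + 2 * a * c + γ + δ) * X ^ 2 +
      C (2 * b * c) * X ^ 3 + C (c ^ 2 - γ * δ) * X ^ 4 : L[X]) = 0 := by
    simp only [map_add, map_sub, map_mul, map_pow, map_one, map_ofNat]
    linear_combination -hQ
  have hcoeff (n : ℕ) := congrArg (coeff · n) hexp
  simp only [coeff_add, coeff_C_mul, coeff_C, coeff_X, coeff_X_pow, coeff_zero] at hcoeff
  have h0 : a ^ 2 - 1 = 0 := by simpa using hcoeff 0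
  have h1 : 2 * a * b = 0 := by simpa using hcoeff 1
  have h3 : b ^ 2 + 2 * a * c + γ + δ = 0 := by simpa using hcoeff 2
  have h4 : c ^ 2 - γ * δ = 0 := by simpa using hcoeff 4
  have ha : a ≠ 0 := by rintro rfl; simp at h0
  have hb : b = 0 := by simpa [h2, ha] using h1
  subst hb
  -- From a² = 1, c² = γδ and 2ac = -(γ + δ) follows (γ + δ)² = 4γδ.
  have : (γ - δ) ^ 2 = 0 := by
    linear_combination (γ + δ - 2 * a * c) * h3 + 4 * a ^ 2 * h4 + 4 * γ * δ * h0
  exact sub_eq_zero.1 (pow_eq_zero_iff two_ne_zero |>.1 this)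

theorem not_isSquare_one_sub {γ : L} (h2 : (2 : L) ≠ 0) (hγ : γ ≠ 0) :
    ¬ IsSquare (1 - C γ * X ^ 2 : L[X]) := fun h =>
  hγ (eq_of_isSquare_mul h2 (by simpa using h) : γ = 0)

end square

/-! ### Transfer to Laurent series and degree criteria -/

section laurent

open PowerSeries
open scoped RatFunc

variable {L : Type*} [Field L]

/-- A polynomial, viewed as a rational function, a power series or a Laurent series. -/
theorem algebraMap_ratFunc_polynomial (P : Polynomial L) :
    algebraMap (RatFunc L) (LaurentSeries L) (algebraMap _ (RatFunc L) P) =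
      HahnSeries.ofPowerSeries ℤ L (P : L⟦X⟧) :=
  (RatFunc.coe_coe P).symm

theorem ofPowerSeries_ne_zero {f : L⟦X⟧} (hf : f ≠ 0) : HahnSeries.ofPowerSeries ℤ L f ≠ 0 :=
  (map_ne_zero_iff _ HahnSeries.ofPowerSeries_injective).2 hf

/-- As Z² = 1/D, the square of ZA/R is D times a rational square. Nonsquareness is therefore to be
tested on D alone. -/
theorem sq_ofPowerSeries_div {Z : L⟦X⟧} {A D R : Polynomial L} (hR : R ≠ 0)
    (hZ : Z ^ 2 * D = 1) :
    (HahnSeries.ofPowerSeries ℤ L (Z * A) / HahnSeries.ofPowerSeries ℤ L (R : L⟦X⟧)) ^ 2 =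
      algebraMap (RatFunc L) (LaurentSeries L)
        (algebraMap _ (RatFunc L) D * (algebraMap _ (RatFunc L) A /
          (algebraMap _ (RatFunc L) D * algebraMap _ (RatFunc L) R)) ^ 2) := by
  have hD : (D : L⟦X⟧) ≠ 0 := by rintro h; rw [h] at hZ; simp at hZ
  have hR' : (R : L⟦X⟧) ≠ 0 := by simpa using hR
  have hD' := ofPowerSeries_ne_zero hD
  have hR'' := ofPowerSeries_ne_zero hR'
  have hZ' := congrArg (HahnSeries.ofPowerSeries ℤ L) hZ
  simp only [map_mul, map_pow, map_div₀, algebraMap_ratFunc_polynomial, map_one] at hZ' ⊢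
  field_simp
  linear_combination HahnSeries.ofPowerSeries ℤ L (A : L⟦X⟧) ^ 2 * hZ'

theorem isSquare_of_isSquare_mul_sq {F : Type*} [Field F] {d k : F} (hk : k ≠ 0)
    (h : IsSquare (d * k ^ 2)) : IsSquare d := by
  obtain ⟨r, hr⟩ := h
  exact ⟨r / k, by field_simp; linear_combination hr⟩

end laurent

section algebraicDegree

open PowerSeries
open scoped RatFunc

variable {L : Type*} [Field L]

theorem C_sub_C_mul_X_sq_ne_zero {a : L} (ha : a ≠ 0) (b : L) :
    (Polynomial.C a - Polynomial.C b * Polynomial.X ^ 2 : Polynomial L) ≠ 0 := fun h =>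
  ha (by simpa using congrArg (Polynomial.coeff · 0) h)

theorem coe_C_sub_C_mul_X_sq (a b : L) :
    ((Polynomial.C a - Polynomial.C b * Polynomial.X ^ 2 : Polynomial L) : L⟦X⟧) =
      C a - C b * X ^ 2 := by
  simp

theorem algebraMap_ratFunc_div_ne_zero {A D R : Polynomial L} (hA : A ≠ 0) (hD : D ≠ 0)
    (hR : R ≠ 0) : algebraMap _ (RatFunc L) A /
      (algebraMap _ (RatFunc L) D * algebraMap _ (RatFunc L) R) ≠ 0 := by
  have hne {P : Polynomial L} (hP : P ≠ 0) : algebraMap _ (RatFunc L) P ≠ 0 :=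
    (map_ne_zero_iff _ (IsFractionRing.injective (Polynomial L) (RatFunc L))).2 hP
  exact div_ne_zero (hne hA) (mul_ne_zero (hne hD) (hne hR))

theorem isAlgebraicOfDegree_four_of_mul_eq [CharZero L] {f Z₁ Z₂ : L⟦X⟧}
    {A₁ A₂ D₁ D₂ R : Polynomial L} (hA₁ : A₁ ≠ 0) (hA₂ : A₂ ≠ 0) (hR : R ≠ 0)
    (hD₁ : ¬ IsSquare D₁) (hD₂ : ¬ IsSquare D₂) (hD₁₂ : ¬ IsSquare (D₁ * D₂))
    (hZ₁ : Z₁ ^ 2 * D₁ = 1) (hZ₂ : Z₂ ^ 2 * D₂ = 1) (hf : f * R = Z₁ * A₁ + Z₂ * A₂) :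
    IsAlgebraicOfDegree f 4 := by
  have hk₁ := algebraMap_ratFunc_div_ne_zero hA₁ (fun h => hD₁ (by simp [h]) : D₁ ≠ 0) hR
  have hk₂ := algebraMap_ratFunc_div_ne_zero hA₂ (fun h => hD₂ (by simp [h]) : D₂ ≠ 0) hR
  have hsum : HahnSeries.ofPowerSeries ℤ L f =
      HahnSeries.ofPowerSeries ℤ L (Z₁ * A₁) / HahnSeries.ofPowerSeries ℤ L (R : L⟦X⟧) +
      HahnSeries.ofPowerSeries ℤ L (Z₂ * A₂) / HahnSeries.ofPowerSeries ℤ L (R : L⟦X⟧) := by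
    have hR' : HahnSeries.ofPowerSeries ℤ L (R : L⟦X⟧) ≠ 0 :=
      ofPowerSeries_ne_zero (by simpa using hR)
    rw [← add_div, eq_div_iff hR', ← map_mul, ← map_add, hf]
  have two : (2 : RatFunc L) ≠ 0 := by
    rw [← map_ofNat (algebraMap L (RatFunc L)) 2]
    exact (map_ne_zero _).2 two_ne_zero
  have := natDegree_minpoly_of_biquadratic two
    (fun h => hD₁ (isSquare_of_isSquare_ratFunc (isSquare_of_isSquare_mul_sq hk₁ h)))
    (fun h => hD₂ (isSquare_of_isSquare_ratFunc (isSquare_of_isSquare_mul_sq hk₂ h)))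
    (fun h => hD₁₂ (isSquare_of_isSquare_ratFunc (isSquare_of_isSquare_mul_sq
      (mul_ne_zero hk₁ hk₂) (by rw [map_mul, mul_pow, mul_mul_mul_comm]; exact h))))
    (sq_ofPowerSeries_div hR hZ₁) (sq_ofPowerSeries_div hR hZ₂)
  rw [← hsum] at this
  exact ⟨this.1.isAlgebraic, this.2⟩

theorem isAlgebraicOfDegree_two_of_mul_eq {f Z : L⟦X⟧} {A D R : Polynomial L} (hA : A ≠ 0)
    (hR : R ≠ 0) (hD : ¬ IsSquare D) (hZ : Z ^ 2 * D = 1) (hf : f * R = Z * A) :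
    IsAlgebraicOfDegree f 2 := by
  have hk := algebraMap_ratFunc_div_ne_zero hA (fun h => hD (by simp [h]) : D ≠ 0) hR
  have hdiv : HahnSeries.ofPowerSeries ℤ L f =
      HahnSeries.ofPowerSeries ℤ L (Z * A) / HahnSeries.ofPowerSeries ℤ L (R : L⟦X⟧) := by
    have hR' : HahnSeries.ofPowerSeries ℤ L (R : L⟦X⟧) ≠ 0 :=
      ofPowerSeries_ne_zero (by simpa using hR)
    rw [eq_div_iff hR', ← map_mul, hf]
  have := natDegree_minpoly_of_sq
    (fun h => hD (isSquare_of_isSquare_ratFunc (isSquare_of_isSquare_mul_sq hk h)))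
    (sq_ofPowerSeries_div hR hZ)
  rw [← hdiv] at this
  exact ⟨this.1.isAlgebraic, this.2⟩

theorem isAlgebraicOfDegree_four [CharZero L] {f Z₁ Z₂ : L⟦X⟧} {γ₁ γ₂ a₁ a₂ r : L} (h₁ : γ₁ ≠ 0)
    (h₂ : γ₂ ≠ 0) (h₁₂ : γ₁ ≠ γ₂) (hZ₁ : Z₁ ^ 2 * (1 - C γ₁ * X ^ 2) = 1)
    (hZ₂ : Z₂ ^ 2 * (1 - C γ₂ * X ^ 2) = 1)
    (hf : f * (1 - C r * X ^ 2) =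
      Z₁ * (C (1 / 2) - C a₁ * X ^ 2) + Z₂ * (C (1 / 2) - C a₂ * X ^ 2)) :
    IsAlgebraicOfDegree f 4 := by
  have hhalf : (1 / 2 : L) ≠ 0 := by simp
  exact isAlgebraicOfDegree_four_of_mul_eq (C_sub_C_mul_X_sq_ne_zero hhalf a₁)
    (C_sub_C_mul_X_sq_ne_zero hhalf a₂) (C_sub_C_mul_X_sq_ne_zero one_ne_zero r)
    (not_isSquare_one_sub two_ne_zero h₁) (not_isSquare_one_sub two_ne_zero h₂)
    (mt (eq_of_isSquare_mul two_ne_zero) h₁₂) (by simpa using hZ₁) (by simpa using hZ₂)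
    (by rw [coe_C_sub_C_mul_X_sq, coe_C_sub_C_mul_X_sq, coe_C_sub_C_mul_X_sq, map_one, hf])

theorem isAlgebraicOfDegree_two [CharZero L] {f Z : L⟦X⟧} {γ a r : L} (hγ : γ ≠ 0)
    (hZ : Z ^ 2 * (1 - C γ * X ^ 2) = 1)
    (hf : f * (1 - C r * X ^ 2) = Z * (1 - C a * X ^ 2)) :
    IsAlgebraicOfDegree f 2 :=
  isAlgebraicOfDegree_two_of_mul_eq (C_sub_C_mul_X_sq_ne_zero one_ne_zero a)
    (C_sub_C_mul_X_sq_ne_zero one_ne_zero r) (not_isSquare_one_sub two_ne_zero hγ)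
    (by simpa using hZ) (by rw [coe_C_sub_C_mul_X_sq, coe_C_sub_C_mul_X_sq, map_one, hf])

end algebraicDegree

/-! ### Degree 4 of the weighted generating function -/

section weighted

variable {K : Type*} [Field K]

theorem algebraMap_mvPolynomial_ne_zero {P : MvPolynomial (Fin 2) K}
    (hP : MvPolynomial.eval 0 P ≠ 0) : algebraMap (MvPolynomial (Fin 2) K) (RatXY K) P ≠ 0 := by
  refine (map_ne_zero_iff _ (IsFractionRing.injective _ _)).2 ?_
  rintro rfl
  simp at hP

theorem varX_ne_zero : varX K ≠ 0 :=
  (map_ne_zero_iff _ (IsFractionRing.injective _ _)).2 (MvPolynomial.X_ne_zero 0)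

theorem varY_ne_zero : varY K ≠ 0 :=
  (map_ne_zero_iff _ (IsFractionRing.injective _ _)).2 (MvPolynomial.X_ne_zero 1)

theorem algebraMap_eq_C (a : K) :
    algebraMap K (RatXY K) a = algebraMap (MvPolynomial (Fin 2) K) (RatXY K) (MvPolynomial.C a) :=
  IsScalarTower.algebraMap_apply K (MvPolynomial (Fin 2) K) (RatXY K) a

theorem isAlgebraicOfDegree_dyckB [CharZero K] {p : Finset ℤ → K} (hp : ∀ s ∈ dyckNSteps, p s ≠ 0) :
    IsAlgebraicOfDegree (dyckB p) 4 := by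
  have hm : p {-1} ≠ 0 := hp _ (mem_dyckNSteps.2 (.inl rfl))
  have h1 : p {1} ≠ 0 := hp _ (mem_dyckNSteps.2 (.inr (.inl rfl)))
  have hq : p {-1, 1} ≠ 0 := hp _ (mem_dyckNSteps.2 (.inr (.inr rfl)))
  have hx := varX_ne_zero (K := K)
  have hy := varY_ne_zero (K := K)
  have : CharZero (RatXY K) :=
    charZero_of_injective_algebraMap (algebraMap K (RatXY K)).injective
  have hinj : ∀ {a : K}, a ≠ 0 → algebraMap K (RatXY K) a ≠ 0 := fun ha => by
    simpa using ha
  have four : (4 : RatXY K) ≠ 0 :=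
    map_ofNat (algebraMap K (RatXY K)) 4 ▸ hinj (OfNat.ofNat_ne_zero 4)
  have e1 : algebraMap K (RatXY K) (p {-1}) + algebraMap K (RatXY K) (p {-1, 1}) * varY K ^ 2 ≠ 0 := by
    rw [algebraMap_eq_C, algebraMap_eq_C, varY, ← map_pow, ← map_mul, ← map_add]
    exact algebraMap_mvPolynomial_ne_zero (by simpa using hm)
  have e2 : algebraMap K (RatXY K) (p {1}) * varX K ^ 2 + algebraMap K (RatXY K) (p {-1, 1}) ≠ 0 := by
    rw [algebraMap_eq_C, algebraMap_eq_C, varX, ← map_pow, ← map_mul, ← map_add]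
    exact algebraMap_mvPolynomial_ne_zero (by simpa using hq)
  have e3 : algebraMap K (RatXY K) (p {1}) * varX K ^ 2 * varY K ^ 2 -
      algebraMap K (RatXY K) (p {-1}) ≠ 0 := by
    rw [algebraMap_eq_C, algebraMap_eq_C, varX, varY, ← map_pow, ← map_pow, ← map_mul, ← map_mul,
      ← map_sub]
    exact algebraMap_mvPolynomial_ne_zero (by simpa using hm)
  refine isAlgebraicOfDegree_four ?_ ?_ ?_ (evenCentralBinomSeries_sq _)
    (evenCentralBinomSeries_sq _)
    (dyckBridgeGF_mul (fun s => algebraMap K (RatXY K) (p s)) hx hy)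
  · exact mul_ne_zero four (mul_ne_zero (hinj h1) e1)
  · refine mul_ne_zero four (mul_ne_zero (hinj hm) fun h => e2 ?_)
    field_simp at h
    rw [h, mul_zero]
  -- Up to the factor x², the difference c₁ - c₂ is p₋₁,₁(p₁x²y² - p₋₁), which is nonzero.
  · intro h
    have h' := mul_left_cancel₀ four h
    field_simp at h'
    refine mul_ne_zero (hinj hq) e3 ?_
    linear_combination h'

end weighted

/-! ### The unweighted generating function -/

section unweighted

open PowerSeries

variable (K : Type*) [Field K]

theorem dyckB11_mul [CharZero K] : dyckB11 K * (1 - C 9 * X ^ 2) = evenCentralBinomSeries 2 * (1 - C 6 * X ^ 2) := by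
  have h := dyckBridgeGF_mul (fun _ => (1 : K)) one_ne_zero one_ne_zero
  have e : stepWeight (fun _ => (1 : K)) 1 1 = 3 := by norm_num [stepWeight]
  have h2 : (1 : K) * (1 + 1 * 1 ^ 2) = 2 := by norm_num
  have h1 : (1 : K⟦X⟧) = 2 * C (1 / 2) := by
    rw [← map_ofNat C 2, ← map_mul, ← map_one C]
    norm_num
  have h6 : (C 6 : K⟦X⟧) = 2 * C 3 := by
    rw [← map_ofNat C 2, ← map_mul]
    norm_num
  have h9 : (9 : K) = 3 ^ 2 := by norm_num
  simp only [e, inv_one, h2] at h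
  simp only [one_mul] at h
  rw [h6, h9, dyckB11, h]
  linear_combination -evenCentralBinomSeries (2 : K) * h1

theorem isAlgebraicOfDegree_dyckB11 [CharZero K] : IsAlgebraicOfDegree (dyckB11 K) 2 :=
  isAlgebraicOfDegree_two (γ := 4 * 2) (by norm_num) (evenCentralBinomSeries_sq 2) (dyckB11_mul K)

theorem exists_sqrt_dyckB11 [CharZero K] : ∃ S : K⟦X⟧, constantCoeff S = 1 ∧ S ^ 2 = 1 - 8 * X ^ 2 ∧
    dyckB11 K = (1 - 6 * X ^ 2) * (S * (1 - 9 * X ^ 2))⁻¹ := by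
  have hZ := evenCentralBinomSeries_sq (2 : K)
  have hB := dyckB11_mul K
  have h0 := constantCoeff_evenCentralBinomSeries (2 : K)
  rw [show (4 * 2 : K) = 8 by norm_num, map_ofNat] at hZ
  rw [map_ofNat, map_ofNat] at hB
  -- Z is 1/√(1 - 8t²), so the root itself is Z(1 - 8t²).
  refine ⟨evenCentralBinomSeries 2 * (1 - 8 * X ^ 2), by simp [h0], ?_, ?_⟩
  · linear_combination (1 - 8 * X ^ 2) * hZ
  · rw [PowerSeries.eq_mul_inv_iff_mul_eq (by simp [h0])]
    linear_combination evenCentralBinomSeries 2 * (1 - 8 * X ^ 2) * hB + (1 - 6 * X ^ 2) * hZ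

theorem coeff_dyckB11 (n : ℕ) : coeff n (dyckB11 K) = ((dyckNBridges n).card : K) := by
  simp [dyckB11, dyckBridgeGF]

theorem card_dyckNBridges_odd (m : ℕ) : (dyckNBridges (2 * m + 1)).card = 0 := by
  have h := coeff_dyckB11 ℚ (2 * m + 1)
  rw [dyckB11, dyckBridgeGF_eq_expand, coeff_expand_of_not_dvd _ _ _ (by omega)] at h
  exact_mod_cast h.symm

theorem card_dyckNBridges_zero : (dyckNBridges 0).card = 1 := by
  have h := coeff_dyckB11 ℚ (2 * 0)
  rw [dyckB11, dyckBridgeGF_eq_expand, coeff_expand_mul, coeff_mk,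
    bridgeSum_zero _ one_ne_zero one_ne_zero] at h
  exact_mod_cast h.symm

theorem card_dyckNBridges_succ [CharZero K] (m : ℕ) :
    ((dyckNBridges (2 * (m + 1))).card : K) = 9 * (dyckNBridges (2 * m)).card +
      2 ^ (m + 1) * (m + 1).centralBinom - 6 * 2 ^ m * m.centralBinom := by
  have h := bridgeSum_succ (fun _ => (1 : K)) one_ne_zero one_ne_zero m
  have e (m : ℕ) : bridgeSum (fun _ => (1 : K)) 1 1 m = (dyckNBridges (2 * m)).card := by
    simp [bridgeSum]
  have e2 : stepWeight (fun _ => (1 : K)) 1 1 = 3 := by norm_num [stepWeight]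
  have h2 : (1 : K) * (1 + 1 * 1 ^ 2) = 2 := by norm_num
  simp only [e, e2, inv_one, h2] at h
  linear_combination h / 2

theorem trunc_dyckB11 [CharZero K] : trunc 10 (dyckB11 K) =
    1 + 7 * Polynomial.X ^ 2 + 63 * Polynomial.X ^ 4 + 583 * Polynomial.X ^ 6
      + 5407 * Polynomial.X ^ 8 := by
  have c0 : ((dyckNBridges (2 * 0)).card : ℚ) = 1 := by
    exact_mod_cast card_dyckNBridges_zero
  have b1 : (Nat.centralBinom 1 : ℚ) = 2 := by norm_num [Nat.centralBinom, Nat.choose]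
  have b2 : (Nat.centralBinom 2 : ℚ) = 6 := by norm_num [Nat.centralBinom, Nat.choose]
  have b3 : (Nat.centralBinom 3 : ℚ) = 20 := by norm_num [Nat.centralBinom, Nat.choose]
  have b4 : (Nat.centralBinom 4 : ℚ) = 70 := by norm_num [Nat.centralBinom, Nat.choose]
  have c1 := card_dyckNBridges_succ ℚ 0
  have c2 := card_dyckNBridges_succ ℚ 1
  have c3 := card_dyckNBridges_succ ℚ 2
  have c4 := card_dyckNBridges_succ ℚ 3
  simp only [Nat.centralBinom_zero, b1, b2, b3, b4, c0, Nat.reduceAdd, Nat.reduceMul] at c1 c2 c3 c4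
  rw [c1] at c2
  rw [c2] at c3
  rw [c3] at c4
  norm_num at c1 c2 c3 c4
  have d1 : (dyckNBridges 2).card = 7 := by exact_mod_cast c1
  have d2 : (dyckNBridges 4).card = 63 := by exact_mod_cast c2
  have d3 : (dyckNBridges 6).card = 583 := by exact_mod_cast c3
  have d4 : (dyckNBridges 8).card = 5407 := by exact_mod_cast c4
  have o0 : (dyckNBridges 1).card = 0 := card_dyckNBridges_odd 0
  have o1 : (dyckNBridges 3).card = 0 := card_dyckNBridges_odd 1
  have o2 : (dyckNBridges 5).card = 0 := card_dyckNBridges_odd 2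
  have o3 : (dyckNBridges 7).card = 0 := card_dyckNBridges_odd 3
  have o4 : (dyckNBridges 9).card = 0 := card_dyckNBridges_odd 4
  iterate 10 rw [trunc_succ]
  simp only [trunc_zero',
    coeff_dyckB11, card_dyckNBridges_zero, d1, d2, d3, d4, o0, o1, o2, o3, o4, Nat.cast_zero,
    map_zero, add_zero, zero_add, Nat.cast_one, Nat.cast_ofNat, pow_zero, mul_one,
    map_one, ← Polynomial.C_mul_X_pow_eq_monomial, map_ofNat]

end unweighted

/-! ### Asymptotics of the number of N-bridges -/

section asymptotics

theorem card_dyckNWalks (n : ℕ) : (dyckNWalks n).card = 3 ^ n := by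
  rw [dyckNWalks, Fintype.card_piFinset_const]
  rfl

/-- A positive endpoint leaves at most m steps of weight 2, so each walk weighs at most 2^m, and
there are 4^m walks. -/
theorem posSum_one_bounds (ω : Finset ℤ → ℝ) (σ : Finset ℤ → ℤ)
    (h : ∀ g : ℤ → ℝ, ∑ s ∈ dyckNSteps, ω s * g (σ s) = 2 * g (-1) + 1 * g 1) (m : ℕ) :
    0 ≤ posSum ω σ 1 m ∧ posSum ω σ 1 m ≤ 8 ^ m := by
  rw [posSum, walkSum_eq ω σ h]
  constructor
  · refine Finset.sum_nonneg fun ij _ => ?_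
    simp only [one_zpow]
    split_ifs <;> positivity
  · have h8 : (8 : ℝ) ^ m =
        ∑ ij ∈ Finset.HasAntidiagonal.antidiagonal (2 * m), ((2 * m).choose ij.1 : ℝ) * 2 ^ m := by
      rw [← Finset.sum_mul, Finset.Nat.sum_antidiagonal_eq_sum_range_succ_mk]
      have := Nat.sum_range_choose (2 * m)
      rw [← Nat.cast_sum, this, pow_mul]
      push_cast
      rw [← mul_pow]
      norm_num
    rw [h8]
    refine Finset.sum_le_sum fun ij hij => ?_
    have hsum := Finset.HasAntidiagonal.mem_antidiagonal.1 hij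
    refine mul_le_mul_of_nonneg_left ?_ (Nat.cast_nonneg _)
    split_ifs with h0
    · rw [one_zpow, mul_one, one_pow, one_mul]
      exact pow_le_pow_right₀ one_le_two (by omega)
    · rw [mul_zero]
      positivity

theorem nonBridges_bounds (m : ℕ) :
    0 ≤ (9 : ℝ) ^ m - (dyckNBridges (2 * m)).card ∧
      (9 : ℝ) ^ m - (dyckNBridges (2 * m)).card ≤ 2 * 8 ^ m := by
  have h := bridgeSum_eq (fun _ => (1 : ℝ)) one_ne_zero one_ne_zero m
  have e : bridgeSum (fun _ => (1 : ℝ)) 1 1 m = (dyckNBridges (2 * m)).card := by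
    simp [bridgeSum]
  have e2 : stepWeight (fun _ => (1 : ℝ)) 1 1 = 3 := by norm_num [stepWeight]
  have e3 : (3 : ℝ) ^ 2 = 9 := by norm_num
  rw [e, e2, inv_one, pow_mul, e3] at h
  have h1 := posSum_one_bounds (fun s => 1 * 1 ^ stepMax s) stepMin (fun g => by
    rw [sum_dyckNSteps_stepMin (fun _ => (1 : ℝ))]; norm_num) m
  have h2 := posSum_one_bounds (fun s => 1 * 1 ^ stepMin s) (fun s => -stepMax s) (fun g => by
    rw [sum_dyckNSteps_stepMax (fun _ => (1 : ℝ))]; norm_num) m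
  constructor <;> linarith [h1.1, h1.2, h2.1, h2.2]

/-- The normalized central binomial coefficient `binom(2m, m) / 4 ^ m`. -/
noncomputable def centralRatio (m : ℕ) : ℝ := m.centralBinom / 4 ^ m

theorem centralRatio_nonneg (m : ℕ) : 0 ≤ centralRatio m := by
  rw [centralRatio]; positivity

theorem centralRatio_le_one (m : ℕ) : centralRatio m ≤ 1 := by
  rw [centralRatio, div_le_one (by positivity)]
  exact_mod_cast Nat.centralBinom_le_four_pow m

theorem centralRatio_succ (m : ℕ) :
    centralRatio (m + 1) = centralRatio m - centralRatio m / (2 * (m + 1)) := by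
  have h : ((m + 1 : ℝ) * (m + 1).centralBinom) = 2 * (2 * m + 1) * m.centralBinom := by
    exact_mod_cast congrArg (Nat.cast (R := ℝ)) (Nat.succ_mul_centralBinom_succ m)
  have h' : ((m + 1).centralBinom : ℝ) = 2 * (2 * m + 1) * m.centralBinom / (m + 1) := by
    field_simp
    linear_combination h
  rw [centralRatio, centralRatio, h', pow_succ]
  field_simp
  ring

/-- Two terms approximate the number of walks that are not bridges. -/
theorem nonBridges_approx (m : ℕ) :
    |((9 : ℝ) ^ m - (dyckNBridges (2 * m)).card) / 8 ^ m - 2 * centralRatio m| ≤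
      12 * (centralRatio m / (m + 1)) := by
  set δ : ℕ → ℝ := fun m =>
    ((9 : ℝ) ^ m - (dyckNBridges (2 * m)).card) / 8 ^ m - 2 * centralRatio m with hδ
  have hbound (m : ℕ) : |δ m| ≤ 2 := by
    obtain ⟨h1, h2⟩ := nonBridges_bounds m
    have h3 := centralRatio_nonneg m
    have h4 := centralRatio_le_one m
    have h5 : ((9 : ℝ) ^ m - (dyckNBridges (2 * m)).card) / 8 ^ m ≤ 2 := by
      rwa [div_le_iff₀ (by positivity)]
    have h6 : 0 ≤ ((9 : ℝ) ^ m - (dyckNBridges (2 * m)).card) / 8 ^ m := by positivity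
    rw [abs_le]
    constructor <;> simp only [hδ] <;> linarith
  -- Solved for the earlier term: forwards the factor 9/8 would amplify errors, backwards 8/9 damps
  -- them.
  have hrec (m : ℕ) : δ m = 8 / 9 * δ (m + 1) - 4 / 3 * (centralRatio m / (m + 1)) := by
    have hc := card_dyckNBridges_succ ℝ m
    have h2 : (2 : ℝ) ^ (m + 1) * (m + 1).centralBinom = 8 ^ (m + 1) * centralRatio (m + 1) := by
      rw [centralRatio, show (8 : ℝ) = 2 * 4 by norm_num, mul_pow]
      field_simp
    have h3 : (2 : ℝ) ^ m * m.centralBinom = 8 ^ m * centralRatio m := by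
      rw [centralRatio, show (8 : ℝ) = 2 * 4 by norm_num, mul_pow]
      field_simp
    have h4 : ((dyckNBridges (2 * (m + 1))).card : ℝ) = 9 * (dyckNBridges (2 * m)).card +
        8 ^ (m + 1) * centralRatio (m + 1) - 6 * (8 ^ m * centralRatio m) := by
      rw [hc, h2, mul_assoc, h3]
    simp only [hδ]
    rw [h4, centralRatio_succ, pow_succ, pow_succ]
    field_simp
    ring
  have hanti (m : ℕ) : centralRatio (m + 1) / ((m + 1 : ℕ) + 1) ≤ centralRatio m / (m + 1) := by
    have h3 := centralRatio_nonneg m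
    have h5 : centralRatio (m + 1) ≤ centralRatio m := by
      rw [centralRatio_succ, sub_le_self_iff]
      positivity
    push_cast
    gcongr
    linarith
  -- The constant 12 is the fixed point of C = (8/9)C + 4/3; the crude bound 2 on `δ` decays
  -- geometrically.
  have key (k : ℕ) : ∀ m, |δ m| ≤ 12 * (centralRatio m / (m + 1)) + 2 * (8 / 9) ^ k := by
    induction k with
    | zero =>
      intro m
      have h3 := centralRatio_nonneg m
      have : 0 ≤ centralRatio m / (m + 1) := by positivity
      linarith [hbound m]
    | succ k ih =>
      intro m
      have h3 := centralRatio_nonneg m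
      have h4 : 0 ≤ centralRatio m / (m + 1) := by positivity
      have h5 := abs_le.1 (ih (m + 1))
      have h6 := hanti m
      rw [pow_succ, abs_le, hrec m]
      constructor <;> linarith [h5.1, h5.2]
  have hlim : Tendsto (fun k : ℕ => 12 * (centralRatio m / (m + 1)) + 2 * (8 / 9 : ℝ) ^ k) atTop
      (nhds (12 * (centralRatio m / (m + 1)) + 2 * 0)) :=
    ((tendsto_pow_atTop_nhds_zero_of_lt_one (by norm_num) (by norm_num)).const_mul 2).const_add _
  rw [mul_zero, add_zero] at hlim
  exact ge_of_tendsto' hlim fun k => key k m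

theorem centralRatio_sq_mul_wallis (m : ℕ) :
    centralRatio m ^ 2 * (2 * m + 1) * Real.Wallis.W m = 1 := by
  have h : (m.centralBinom * m.factorial * m.factorial : ℝ) = (2 * m).factorial := by
    have := Nat.choose_mul_factorial_mul_factorial (show m ≤ 2 * m by omega)
    rw [show 2 * m - m = m by omega] at this
    exact_mod_cast this
  rw [Real.Wallis.W_eq_factorial_ratio, ← h, centralRatio,
    show (2 : ℝ) ^ (4 * m) = (4 ^ m) ^ 2 by rw [← pow_mul, mul_comm m, pow_mul, pow_mul]; norm_num]
  have := Nat.centralBinom_pos m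
  have := Nat.factorial_pos m
  field_simp

/-- Both bounds come from the Wallis product W(m), which lies between (2m + 1)/(2m + 2) · π/2 and
π/2. -/
theorem centralRatio_bounds {m : ℕ} (hm : 0 < m) :
    centralRatio m ≤ 1 / √(Real.pi * m) ∧
      1 / √(Real.pi * m) - centralRatio m ≤ 1 / √(Real.pi * m) / (2 * m) := by
  have hπ := Real.pi_pos
  have hm' : (0 : ℝ) < m := by exact_mod_cast hm
  have h0 := centralRatio_nonneg m
  have hw := centralRatio_sq_mul_wallis m
  have h1 := Real.Wallis.W_le m
  have h2 := Real.Wallis.le_W m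
  set a := centralRatio m
  set q := 1 / √(Real.pi * m) with hq
  have hq0 : 0 ≤ q := by positivity
  have hq2 : q ^ 2 * (Real.pi * m) = 1 := by
    rw [hq, div_pow, Real.sq_sqrt (by positivity)]
    field_simp
  constructor
  · refine le_of_sq_le_sq ?_ hq0
    have hA : a ^ 2 * (2 * m + 1) * ((2 * m + 1) / (2 * m + 2) * (Real.pi / 2)) ≤ 1 := by
      refine le_trans ?_ hw.le
      gcongr
    have hB : (m : ℝ) ≤ (2 * m + 1) * ((2 * m + 1) / (2 * m + 2)) / 2 := by
      field_simp
      nlinarith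
    have hC : a ^ 2 * (Real.pi * m) ≤ 1 := by
      refine le_trans ?_ hA
      calc a ^ 2 * (Real.pi * m)
          ≤ a ^ 2 * (Real.pi * ((2 * m + 1) * ((2 * m + 1) / (2 * m + 2)) / 2)) := by gcongr
        _ = _ := by ring
    rw [← hq2] at hC
    exact le_of_mul_le_mul_right hC (by positivity)
  · have h3 : q * (2 * m / (2 * m + 1)) ≤ a := by
      refine le_of_sq_le_sq ?_ h0
      have hA : 1 ≤ a ^ 2 * (2 * m + 1) * (Real.pi / 2) := by
        refine hw.ge.trans ?_
        gcongr
      have hB : (2 * m / (2 * m + 1) : ℝ) ≤ 1 := by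
        rw [div_le_one (by positivity)]
        linarith
      calc (q * (2 * m / (2 * m + 1))) ^ 2
          = q ^ 2 * (2 * m / (2 * m + 1)) * (2 * m / (2 * m + 1)) := by ring
        _ ≤ q ^ 2 * (2 * m / (2 * m + 1)) * 1 := by gcongr
        _ = q ^ 2 * (Real.pi * m) * (2 / ((2 * m + 1) * Real.pi)) := by field_simp
        _ ≤ a ^ 2 := by
          rw [hq2, one_mul, div_le_iff₀ (by positivity)]
          linarith
    have h4 : q * (2 * m / (2 * m + 1)) = q - q / (2 * m + 1) := by
      field_simp
      ring
    have h5 : q / (2 * m + 1) ≤ q / (2 * m) := by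
      gcongr
      linarith
    linarith

theorem tendsto_card_dyckNBridges :
    Tendsto (fun m : ℕ => ((dyckNBridges (2 * m)).card : ℝ) / ((dyckNWalks (2 * m)).card : ℝ))
      atTop (nhds 1) := by
  have hlim : Tendsto (fun m : ℕ => 1 - 2 * (8 / 9 : ℝ) ^ m) atTop (nhds (1 - 2 * 0)) :=
    ((tendsto_pow_atTop_nhds_zero_of_lt_one (by norm_num) (by norm_num)).const_mul 2).const_sub _
  rw [mul_zero, sub_zero] at hlim
  have hcard (m : ℕ) : ((dyckNWalks (2 * m)).card : ℝ) = 9 ^ m := by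
    rw [card_dyckNWalks, pow_mul]
    norm_num
  refine tendsto_of_tendsto_of_tendsto_of_le_of_le hlim tendsto_const_nhds (fun m => ?_) fun m => ?_
  · have h := (nonBridges_bounds m).2
    simp only [hcard]
    rw [le_div_iff₀ (by positivity), sub_mul, one_mul, mul_assoc, ← mul_pow]
    norm_num
    linarith
  · have h := (nonBridges_bounds m).1
    simp only [hcard]
    rw [div_le_one (by positivity)]
    linarith

/-- The error term in the asymptotic expansion of the number of Dyck N-bridges of even length. -/
theorem abs_card_dyckNBridges_sub_le {m : ℕ} (hm : 0 < m) :
    |((dyckNBridges (2 * m)).card : ℝ) - 9 ^ m + 2 * (1 / √(Real.pi * m)) * 8 ^ m| ≤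
      13 * (1 / √(Real.pi * m) / m) * 8 ^ m := by
  have hm' : (0 : ℝ) < m := by exact_mod_cast hm
  obtain ⟨h1, h2⟩ := centralRatio_bounds hm
  have h3 := nonBridges_approx m
  have h0 := centralRatio_nonneg m
  have hq0 : 0 ≤ 1 / √(Real.pi * m) := by positivity
  set q := 1 / √(Real.pi * m)
  set a := centralRatio m
  set r := ((9 : ℝ) ^ m - (dyckNBridges (2 * m)).card) / 8 ^ m with hr
  have e : ((dyckNBridges (2 * m)).card : ℝ) - 9 ^ m + 2 * q * 8 ^ m =
      (2 * (q - a) - (r - 2 * a)) * 8 ^ m := by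
    rw [hr]
    field_simp
    ring
  rw [e, abs_mul, abs_of_nonneg (by positivity : (0 : ℝ) ≤ 8 ^ m)]
  refine mul_le_mul_of_nonneg_right ?_ (by positivity)
  have h4 : a / (m + 1) ≤ q / m := by
    gcongr
    linarith
  have h5 : 2 * (q / (2 * m)) = q / m := by
    field_simp
  have h6 := abs_le.1 h3
  have h7 : 0 ≤ q / m := by positivity
  rw [abs_le]
  constructor <;> linarith [h6.1, h6.2]

theorem card_dyckNBridges_asymptotics : ∃ e : ℕ → ℝ,
    (e =O[atTop] fun n : ℕ => (8 : ℝ) ^ ((n : ℝ) / 2) / (n : ℝ) ^ ((3 : ℝ) / 2)) ∧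
    ∀ n : ℕ, 0 < n → ((dyckNBridges n).card : ℝ) =
      (1 + (-1) ^ n) / 2 *
        (3 ^ n - 2 * √2 / √Real.pi * ((8 : ℝ) ^ ((n : ℝ) / 2) / √(n : ℝ)) + e n) := by
  -- At odd n the prefactor vanishes, so the error may be set to 0 there.
  refine ⟨fun n => if Even n then ((dyckNBridges n).card : ℝ) - 3 ^ n +
    2 * √2 / √Real.pi * ((8 : ℝ) ^ ((n : ℝ) / 2) / √(n : ℝ)) else 0, ?_, fun n _ => ?_⟩
  -- 39 = 13 · 2 · 3/2: the bound 13 for even length, n = 2m, and √2 ≤ 3/2.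
  · refine IsBigO.of_bound 39 (eventually_atTop.2 ⟨1, fun n hn => ?_⟩)
    rcases Nat.even_or_odd' n with ⟨m, rfl | rfl⟩
    · have hm : 0 < m := by omega
      have hm' : (0 : ℝ) < m := by exact_mod_cast hm
      have hπ := Real.pi_pos
      have e1 : (8 : ℝ) ^ (((2 * m : ℕ) : ℝ) / 2) = 8 ^ m := by
        rw [← Real.rpow_natCast]
        congr 1
        push_cast
        ring
      have e2 : ((2 * m : ℕ) : ℝ) ^ ((3 : ℝ) / 2) = 2 * m * (√2 * √m) := by
        rw [show (3 : ℝ) / 2 = 1 + 1 / 2 by norm_num, Real.rpow_add (by positivity), Real.rpow_one,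
          ← Real.sqrt_eq_rpow]
        push_cast
        rw [Real.sqrt_mul zero_le_two]
      have e3 : 2 * √2 / √Real.pi * ((8 : ℝ) ^ m / √((2 * m : ℕ) : ℝ)) =
          2 * (1 / √(Real.pi * m)) * 8 ^ m := by
        push_cast
        rw [Real.sqrt_mul zero_le_two, Real.sqrt_mul hπ.le]
        field_simp
      have e4 : (3 : ℝ) ^ (2 * m) = 9 ^ m := by
        rw [pow_mul]
        norm_num
      rw [if_pos (even_two_mul m), e1, e2, e3, e4, Real.norm_eq_abs, Real.norm_eq_abs,
        abs_of_nonneg (by positivity : (0 : ℝ) ≤ 8 ^ m / (2 * m * (√2 * √m)))]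
      refine (abs_card_dyckNBridges_sub_le hm).trans ?_
      have hsqrt : 1 ≤ √Real.pi := by
        rw [Real.one_le_sqrt]
        linarith [Real.pi_gt_three]
      have hsqrt2 : √2 ≤ 3 / 2 := by
        rw [Real.sqrt_le_left (by norm_num)]
        norm_num
      calc 13 * (1 / √(Real.pi * m) / m) * 8 ^ m
          = 13 * (8 ^ m / (√Real.pi * √m * m)) := by
            rw [Real.sqrt_mul hπ.le]
            field_simp
        _ ≤ 13 * (8 ^ m / (1 * √m * m)) := by gcongr
        _ = 26 * √2 * (8 ^ m / (2 * m * (√2 * √m))) := by field_simp; norm_num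
        _ ≤ 39 * (8 ^ m / (2 * m * (√2 * √m))) := by
          gcongr
          linarith
    · rw [if_neg (by simp), norm_zero]
      positivity
  · rcases Nat.even_or_odd' n with ⟨m, rfl | rfl⟩
    · simp only [if_pos (even_two_mul m), (even_two_mul m).neg_one_pow]
      ring
    · rw [card_dyckNBridges_odd, (odd_two_mul_add_one m).neg_one_pow]
      simp

end asymptotics

end NWalk

theorem mainTheorem5 {K : Type*} [Field K] [CharZero K] :
    -- the weighted generating function is algebraic of degree 4
    (∀ p : Finset ℤ → K, (∀ s ∈ NWalk.dyckNSteps, p s ≠ 0) →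
      NWalk.IsAlgebraicOfDegree (NWalk.dyckB p) 4) ∧
    -- the unweighted generating function: degree, closed form, first coefficients
    NWalk.IsAlgebraicOfDegree (NWalk.dyckB11 K) 2 ∧
    (∃ S : K⟦X⟧, PowerSeries.constantCoeff S = 1 ∧ S ^ 2 = 1 - 8 * PowerSeries.X ^ 2 ∧
      NWalk.dyckB11 K =
        (1 - 6 * PowerSeries.X ^ 2) * (S * (1 - 9 * PowerSeries.X ^ 2))⁻¹) ∧
    PowerSeries.trunc 10 (NWalk.dyckB11 K) =
      1 + 7 * Polynomial.X ^ 2 + 63 * Polynomial.X ^ 4 + 583 * Polynomial.X ^ 6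
        + 5407 * Polynomial.X ^ 8 ∧
    -- its coefficients count the Dyck N-bridges, with the following asymptotics
    (∀ n : ℕ, PowerSeries.coeff n (NWalk.dyckB11 K) = ((NWalk.dyckNBridges n).card : K)) ∧
    (∃ e : ℕ → ℝ,
      (e =O[atTop] fun n : ℕ => (8 : ℝ) ^ ((n : ℝ) / 2) / (n : ℝ) ^ ((3 : ℝ) / 2)) ∧
      ∀ n : ℕ, 0 < n → ((NWalk.dyckNBridges n).card : ℝ) =
        (1 + (-1) ^ n) / 2 *
          (3 ^ n - 2 * √2 / √Real.pi * ((8 : ℝ) ^ ((n : ℝ) / 2) / √(n : ℝ)) + e n)) ∧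
    -- almost all Dyck N-walks of even length are N-bridges
    Tendsto (fun m : ℕ => ((NWalk.dyckNBridges (2 * m)).card : ℝ) /
      ((NWalk.dyckNWalks (2 * m)).card : ℝ)) atTop (nhds 1) := by
  exact ⟨fun _ hp => NWalk.isAlgebraicOfDegree_dyckB hp, NWalk.isAlgebraicOfDegree_dyckB11 K,
    NWalk.exists_sqrt_dyckB11 K, NWalk.trunc_dyckB11 K, NWalk.coeff_dyckB11 K,
    NWalk.card_dyckNBridges_asymptotics, NWalk.tendsto_card_dyckNBridges⟩
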